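/- Let $\mathcal U$ be a saturated structure in a first-order language $L$ (every finitely satisfiable set of formulas, in a finite tuple of variables, with parameters from a set $A\subseteq\mathcal U$ with $|A|<|\mathcal U|$, is realized in $\mathcal U$) whose cardinality is uncountable, (strongly) inaccessible and larger than $|L|$, and let $T=\mathrm{Th}(\mathcal U)$. Say that a family $u$ of subsets of a set $X$ *shatters* $B\subseteq X$ if every $H\subseteq B$ is of the form $C\cap B$ with $C\in u$, and that $u$ has *finite VC-dimension* if for some $k<\omega$ no $B\subseteq X$ of size $k$ is shattered by $u$. Assume that $T$ is NIP, i.e. for every formula $\varphi(x,z)\in L$ in finite tuples of variables, the family $\{\varphi(b,\mathcal U): b\in\mathcal U^{|x|}\}$ of subsets of $\mathcal U^{|z|}$ has finite VC-dimension. Let $z$ be a finite tuple of variables and let $\mathcal D\subseteq\mathcal U^{|z|}$ be arbitrary. Let $e(\mathcal D)$ be the set of all $\mathcal C\subseteq\mathcal U^{|z|}$ such that the expansions $\langle\mathcal U,\mathcal C\rangle$ and $\langle\mathcal U,\mathcal D\rangle$ of $\mathcal U$ by one new $|z|$-ary predicate are elementarily equivalent. Then the following are equivalent: 1. $\mathcal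 D$ is approximable from below: there is a formula $\varphi(x,z)\in L$, with $x$ a finite tuple, such that for every finite $B\subseteq\mathcal U$ there is $b\in\mathcal U^{|x|}$ with $\varphi(b,\mathcal U)\cap B^{|z|}=\mathcal D\cap B^{|z|}$ and $\varphi(b,\mathcal U)\subseteq\mathcal D$; 2. $e(\mathcal D)$ has finite VC-dimension; 3. $\mathcal D$ is externally definable: there are a finite tuple $x$, a complete global type $p\in S_x(\mathcal U)$ and a formula $\varphi(x,z)\in L$ such that $\mathcal D=\{a\in\mathcal U^{|z|}:\varphi(x,a)\in p\}$. -/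

import Mathlib

open FirstOrder Cardinal

universe u v w

namespace ExtDef

/-- The family `u` shatters `B`: every subset of `B` is the trace over `B` of some member of `u`. -/
def Shatters {α : Type*} (u : Set (Set α)) (B : Set α) : Prop :=
  ∀ H : Set α, H ⊆ B → ∃ C ∈ u, C ∩ B = H

/-- The family `u` has finite VC-dimension: for some `k`, no set of size `k` is shattered. -/
def FiniteVCDim {α : Type*} (u : Set (Set α)) : Prop :=
  ∃ k : ℕ, ∀ B : Finset α, B.card = k → ¬ Shatters u (B : Set α)

/-- `M` is a saturated `L`-structure: for every `A ⊆ M` with `|A| < |M|`, every set of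
`L(A)`-formulas in finitely many variables which is finitely satisfiable in `M` is realized
in `M`. -/
def IsSaturated (L : FirstOrder.Language.{u, v}) (M : Type w) [L.Structure M] : Prop :=
  ∀ A : Set M, #A < #M → ∀ (m : ℕ) (p : Set (L[[A]].Formula (Fin m))),
    (∀ F : Finset (L[[A]].Formula (Fin m)), (F : Set (L[[A]].Formula (Fin m))) ⊆ p →
      ∃ v : Fin m → M, ∀ φ ∈ F, φ.Realize v) →
    ∃ v : Fin m → M, ∀ φ ∈ p, φ.Realize v

/-- The set `φ(b, M) ⊆ Mⁿ`, for a formula `φ(x, z)` and a tuple `b` in place of `x`. -/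
def fiber {L : FirstOrder.Language.{u, v}} {M : Type w} [L.Structure M] {m n : ℕ}
    (φ : L.Formula (Fin m ⊕ Fin n)) (b : Fin m → M) : Set (Fin n → M) :=
  {z | φ.Realize (Sum.elim b z)}

/-- The formula `φ(x, z)` is NIP (in `M`): the sets `φ(b, M)` form a family of finite
VC-dimension. -/
def IsNIPFormula {L : FirstOrder.Language.{u, v}} (M : Type w) [L.Structure M] {m n : ℕ}
    (φ : L.Formula (Fin m ⊕ Fin n)) : Prop :=
  FiniteVCDim (Set.range (fun b : Fin m → M => fiber φ b))

/-- The theory of `M` is NIP: every formula is NIP in `M`. -/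
def IsNIP (L : FirstOrder.Language.{u, v}) (M : Type w) [L.Structure M] : Prop :=
  ∀ (m n : ℕ) (φ : L.Formula (Fin m ⊕ Fin n)), IsNIPFormula M φ

/-- The power `Bⁿ`, as a set of `n`-tuples of `M`. -/
def cube {M : Type w} (B : Set M) (n : ℕ) : Set (Fin n → M) :=
  {z | ∀ i, z i ∈ B}

/-- `D` is approximable from below by `φ(x, z)`: for every finite `B` there is a tuple `b` such
that `φ(b, M)` and `D` have the same trace over `B`, and `φ(b, M) ⊆ D`. -/
def ApproximableFromBelowBy {L : FirstOrder.Language.{u, v}} {M : Type w} [L.Structure M] {m n : ℕ}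
    (φ : L.Formula (Fin m ⊕ Fin n)) (D : Set (Fin n → M)) : Prop :=
  ∀ B : Set M, B.Finite →
    ∃ b : Fin m → M, fiber φ b ∩ cube B n = D ∩ cube B n ∧ fiber φ b ⊆ D

/-- `D` is approximable from below by some formula, the same one for all finite sets. -/
def ApproximableFromBelow (L : FirstOrder.Language.{u, v}) {M : Type w} [L.Structure M] {n : ℕ}
    (D : Set (Fin n → M)) : Prop :=
  ∃ (m : ℕ) (φ : L.Formula (Fin m ⊕ Fin n)), ApproximableFromBelowBy φ D

/-- The formula `φ(x, a)` over `M`, for a formula `φ(x, z)` and a tuple `a` in place of `z`. -/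
def instantiate {L : FirstOrder.Language.{u, v}} {M : Type w} {m n : ℕ}
    (φ : L.Formula (Fin m ⊕ Fin n)) (a : Fin n → M) : L[[M]].Formula (Fin m) :=
  ((L.lhomWithConstants M).onFormula φ).subst
    (Sum.elim (fun i => FirstOrder.Language.Term.var i)
      (fun j => FirstOrder.Language.Constants.term (FirstOrder.Language.con L (a j))))

/-- `D` is externally definable: there are a global type `p ∈ S_x(M)`, with `x` a finite tuple of
variables, and a formula `φ(x, z)` such that `D = {a | φ(x, a) ∈ p}`. -/
def ExternallyDefinable (L : FirstOrder.Language.{u, v}) {M : Type w} [L.Structure M] {n : ℕ}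
    (D : Set (Fin n → M)) : Prop :=
  ∃ (m : ℕ) (p : (L.elementaryDiagram M).CompleteType (Fin m)) (φ : L.Formula (Fin m ⊕ Fin n)),
    D = {a | FirstOrder.Language.Formula.equivSentence (instantiate φ a) ∈ p}

/-- The only relation symbol of `predLanguage n`, of arity `n`. -/
inductive PredRel (n : ℕ) : ℕ → Type
  | mem : PredRel n n

/-- The language with one `n`-ary predicate. -/
abbrev predLanguage (n : ℕ) : FirstOrder.Language.{0, 0} where
  Functions _ := Empty
  Relations := PredRel n

/-- The interpretation of the predicate as `z ∈ D`. -/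
abbrev predStructure {M : Type w} {n : ℕ} (D : Set (Fin n → M)) : (predLanguage n).Structure M where
  funMap f _ := Empty.elim f
  RelMap R :=
    match R with
    | .mem => fun z => z ∈ D

/-- The expansion `⟨M, D⟩` of the `L`-structure `M` by a predicate for `z ∈ D`. -/
abbrev expansion (L : FirstOrder.Language.{u, v}) {M : Type w} [L.Structure M] {n : ℕ}
    (D : Set (Fin n → M)) : (L.sum (predLanguage n)).Structure M :=
  letI := predStructure D
  L.sumStructure (predLanguage n) M

/-- `e(D)`: the collection of all `C` such that `⟨M, C⟩` and `⟨M, D⟩` are elementarily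
equivalent. -/
def eClass (L : FirstOrder.Language.{u, v}) {M : Type w} [L.Structure M] {n : ℕ}
    (D : Set (Fin n → M)) : Set (Set (Fin n → M)) :=
  {C | @FirstOrder.Language.ElementarilyEquivalent (L.sum (predLanguage n)) M M
    (expansion L C) (expansion L D)}

end ExtDef

/-! Conditions 1 and 3 each give one formula φ(x,z) whose instances have the same trace as D on any
finitely many tuples. For each number k of tuples this is a sentence about ⟨U,D⟩ (`traceSentence`),
so every C in e(D) inherits it. A set of size k shattered by e(D) is then shattered by the instances
of φ, and NIP bounds k. Conversely, such a φ makes D externally definable by compactness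
(`externallyDefinable_of_trace`).

The substance is that 2 implies 1. If D is not approximable from below, the sets uniformly covered
inside D form an ideal that omits D, so some ultrafilter W contains D and no such set. Any definable
set that is large for the iterated power of W then contains tuples with every pattern of membership
in D (`exists_mem_paramSet_pattern`). By saturation some c = (c_0,…,c_{k-1}) in U realizes the type
over ∅ of that iterated power. For each S ⊆ k, a predicate with trace S on c is therefore finitely
consistent with the theory of ⟨U,D⟩, and resplendence (`exists_mem_eClass_trace`) yields such a
predicate in e(D). So e(D) shatters sets of every finite size.

Resplendence is proved by a Henkin construction whose witnesses are taken in U. Fewer than |U|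
parameters are in use at each stage, so saturation can copy the L-type of a required witness into U.
In the final model, U passes the Tarski–Vaught test in the expanded language
(`exists_henkin_model`). -/

namespace ExtDef

open FirstOrder.Language

/-! ### Compactness for formulas with free variables -/

section Compactness

universe x y

variable {L : FirstOrder.Language.{u, v}} {α : Type x}

/-- A set of formulas with free variables in `α` is satisfiable when it is realized by an
assignment in some structure. -/
def SatFormulas (S : Set (L.Formula α)) : Prop :=
  Theory.IsSatisfiable (L := L[[α]]) (Formula.equivSentence '' S)

theorem SatFormulas.of_realize {S : Set (L.Formula α)} (M : Type y) [L.Structure M] [Nonempty M]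
    (g : α → M) (h : ∀ φ ∈ S, φ.Realize g) : SatFormulas S := by
  let _ : (constantsOn α).Structure M := constantsOn.structure g
  have : Theory.Model (L := L[[α]]) M (Formula.equivSentence '' S) := by
    refine ⟨?_⟩
    rintro _ ⟨φ, hφ, rfl⟩
    exact (Formula.realize_equivSentence M φ).2 (h φ hφ)
  exact Theory.Model.isSatisfiable M

theorem SatFormulas.exists_realize {S : Set (L.Formula α)} (h : SatFormulas S) :
    ∃ (N : Type (max u v x)) (_ : L.Structure N) (_ : Nonempty N) (g : α → N),
      ∀ φ ∈ S, φ.Realize g := by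
  obtain ⟨M⟩ := h
  let _ : L.Structure M := (L.lhomWithConstants α).reduct M
  have : (L.lhomWithConstants α).IsExpansionOn M := LHom.isExpansionOn_reduct _ _
  refine ⟨M, inferInstance, M.nonempty', fun a => (L.con a : M), fun φ hφ => ?_⟩
  exact (Formula.realize_equivSentence M φ).1
    (Theory.realize_sentence_of_mem _ (Set.mem_image_of_mem _ hφ))

theorem SatFormulas.mono {S S' : Set (L.Formula α)} (h : SatFormulas S') (hS : S ⊆ S') :
    SatFormulas S :=
  Theory.IsSatisfiable.mono h (Set.image_mono hS)

/-- The compactness theorem for sets of formulas with free variables. -/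
theorem satFormulas_of_finite {S : Set (L.Formula α)}
    (h : ∀ F : Set (L.Formula α), F.Finite → F ⊆ S → SatFormulas F) : SatFormulas S := by
  refine Theory.isSatisfiable_iff_isFinitelySatisfiable.2 fun T hT => ?_
  obtain ⟨F, hFS, hF⟩ := Set.subset_image_iff.1 hT
  have hfin : F.Finite := by
    refine Set.Finite.of_finite_image ?_ Formula.equivSentence.injective.injOn
    rw [hF]; exact T.finite_toSet
  have := h F hfin hFS
  rwa [SatFormulas, hF] at this

theorem realize_restrictFreeVar_id [DecidableEq α] {M : Type y} [L.Structure M] (φ : L.Formula α)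
    (g : α → M) :
    Formula.Realize (φ.restrictFreeVar id) (fun a : φ.freeVarFinset => g a) ↔ φ.Realize g :=
  BoundedFormula.realize_restrictFreeVar (φ := φ) (f := id) (v := fun a => g a) g fun _ => rfl

end Compactness

/-! ### Extending partial elementary maps one formula at a time -/

section Transfer

universe x y

variable {L : FirstOrder.Language.{u, v}} {β : Type x} {U : Type w} {N : Type y}
  [L.Structure U] [L.Structure N]

/-- If `χ` is true in `U`, then some formula `ψ` true of `e` guarantees, for every tuple `f` with
the same equalities as `e`, that `χ` is true under an assignment that extends `e b ↦ f b`. -/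
theorem exists_formula_extending [Nonempty N] (e : β → U) (χ : L.Formula U) (hχ : χ.Realize id) :
    ∃ ψ : L.Formula β, ψ.Realize e ∧ ∀ f : β → N, (∀ b b', e b = e b' → f b = f b') →
      ψ.Realize f → ∃ g : U → N, (∀ b, g (e b) = f b) ∧ χ.Realize g := by
  classical
  let χ' : L.Formula χ.freeVarFinset := χ.restrictFreeVar id
  -- A variable in the range of `e` is replaced by a chosen preimage, and the others are bound
  -- existentially. Because of the choice, `f` must respect the equalities of `e`.
  let k : χ.freeVarFinset → β ⊕ χ.freeVarFinset := fun a =>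
    if ha : ∃ b, e b = a then Sum.inl ha.choose else Sum.inr a
  refine ⟨(χ'.relabel k).iExs χ.freeVarFinset, ?_, fun f hef hf => ?_⟩
  · rw [Formula.realize_iExs]
    refine ⟨fun a => a, ?_⟩
    rw [Formula.realize_relabel]
    convert (realize_restrictFreeVar_id χ id).2 hχ using 1
    funext a
    simp only [Function.comp, k]
    split_ifs with ha
    · exact ha.choose_spec
    · rfl
  · rw [Formula.realize_iExs] at hf
    obtain ⟨i, hi⟩ := hf
    rw [Formula.realize_relabel] at hi
    refine ⟨fun a => if ha : ∃ b, e b = a then f ha.choose else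
      if hs : a ∈ χ.freeVarFinset then i ⟨a, hs⟩ else Classical.arbitrary N,
      fun b => ?_, (realize_restrictFreeVar_id χ _).1 ?_⟩
    · have hb : ∃ b', e b' = e b := ⟨b, rfl⟩
      simp only [dif_pos hb]
      exact hef _ _ hb.choose_spec
    · convert hi using 1
      funext a
      simp only [Function.comp, k]
      split_ifs with ha hs
      · rfl
      · rfl
      · exact absurd a.2 hs

/-- If `e` and `f` have the same type, then any formula true in `U` is true in `N` under some
assignment that extends `e b ↦ f b`. -/
theorem exists_realize_extending [Nonempty N] {e : β → U} {f : β → N}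
    (h : ∀ ψ : L.Formula β, ψ.Realize e → ψ.Realize f) (χ : L.Formula U) (hχ : χ.Realize id) :
    ∃ g : U → N, (∀ b, g (e b) = f b) ∧ χ.Realize g := by
  obtain ⟨ψ, hψ, hext⟩ := exists_formula_extending (N := N) e χ hχ
  refine hext f (fun b b' hb => ?_) (h ψ hψ)
  have := h ((Term.var b).equal (Term.var b')) (by simpa [Formula.realize_equal] using hb)
  simpa [Formula.realize_equal] using this

/-- For a finite tuple `e`, the equalities can be absorbed in the formula. -/
theorem exists_formula_extending_of_finite [Finite β] [Nonempty N] (e : β → U) (χ : L.Formula U)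
    (hχ : χ.Realize id) :
    ∃ ψ : L.Formula β, ψ.Realize e ∧ ∀ f : β → N, ψ.Realize f →
      ∃ g : U → N, (∀ b, g (e b) = f b) ∧ χ.Realize g := by
  obtain ⟨ψ, hψ, hext⟩ := exists_formula_extending (N := N) e χ hχ
  let eqs : L.Formula β := Formula.iInf fun x : {x : β × β // e x.1 = e x.2} =>
    (Term.var x.1.1).equal (Term.var x.1.2)
  refine ⟨ψ ⊓ eqs, Formula.realize_inf.2 ⟨hψ, ?_⟩, fun f hf => ?_⟩
  · exact Formula.realize_iInf.2 fun x => by simpa [Formula.realize_equal] using x.2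
  · obtain ⟨h1, h2⟩ := Formula.realize_inf.1 hf
    refine hext f (fun b b' hb => ?_) h1
    simpa [Formula.realize_equal] using Formula.realize_iInf.1 h2 ⟨(b, b'), hb⟩

end Transfer

/-! ### Saturation with parameters as variables -/

section Saturation

variable {L : FirstOrder.Language.{u, v}} {U : Type w} [L.Structure U]

/-- Saturation, with the parameters as free variables. -/
theorem IsSaturated.exists_realize (hU : IsSaturated L U) (A : Set U) (hA : #A < #U) (m : ℕ)
    (p : Set (L.Formula (A ⊕ Fin m)))
    (hp : ∀ F : Set (L.Formula (A ⊕ Fin m)), F.Finite → F ⊆ p →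
      ∃ v : Fin m → U, ∀ φ ∈ F, φ.Realize (Sum.elim (fun a : A => (a : U)) v)) :
    ∃ v : Fin m → U, ∀ φ ∈ p, φ.Realize (Sum.elim (fun a : A => (a : U)) v) := by
  classical
  have key : ∀ (φ : L[[A]].Formula (Fin m)) (v : Fin m → U),
      Formula.Realize (BoundedFormula.constantsVarsEquiv φ : L.Formula (A ⊕ Fin m))
        (Sum.elim (fun a : A => (a : U)) v) ↔ φ.Realize v := fun φ v =>
    BoundedFormula.realize_constantsVarsEquiv
  obtain ⟨v, hv⟩ := hU A hA m {φ | BoundedFormula.constantsVarsEquiv φ ∈ p} (by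
    intro F hF
    obtain ⟨v, hv⟩ := hp (BoundedFormula.constantsVarsEquiv '' (F : Set (L[[A]].Formula (Fin m))))
      (F.finite_toSet.image _) (by rintro _ ⟨φ, hφ, rfl⟩; exact hF hφ)
    exact ⟨v, fun φ hφ => (key φ v).1 (hv _ (Set.mem_image_of_mem _ hφ))⟩)
  refine ⟨v, fun φ hφ => ?_⟩
  have := (key (BoundedFormula.constantsVarsEquiv.symm φ) v).2 (hv _ (by
    simpa using hφ))
  rwa [Equiv.apply_symm_apply] at this

end Saturation

/-! ### Henkin construction with witnesses in a saturated structure -/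

section Resplendence

universe u' v'

variable {L : FirstOrder.Language.{u, v}} {L' : FirstOrder.Language.{u', v'}} (ℓ : L →ᴸ L')
  (U : Type w) [L.Structure U]

/-- The elementary diagram of the `L`-structure `U`, as a set of formulas of an expansion `L'`
with free variables in `U`. -/
def diagram : Set (L'.Formula U) :=
  ℓ.onFormula '' {χ : L.Formula U | χ.Realize id}

/-- The formulas in `S` only depend on the variables in `A`. -/
def SupportedOn {U : Type w} (S : Set (L'.Formula U)) (A : Set U) : Prop :=
  ∀ φ ∈ S, ∀ (N : Type (max u' v' w)) [L'.Structure N] (g g' : U → N),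
    (∀ a ∈ A, g a = g' a) → φ.Realize g → φ.Realize g'

variable {ℓ U}

theorem SupportedOn.mono {S : Set (L'.Formula U)} {A A' : Set U} (h : SupportedOn S A)
    (hA : A ⊆ A') : SupportedOn S A' :=
  fun φ hφ N _ g g' hg => h φ hφ N g g' fun a ha => hg a (hA ha)

/-- The diagram contains each formula or its negation, so satisfying it makes `g` an elementary map.
-/
theorem realize_iff_of_diagram {N : Type*} [L.Structure N] [L'.Structure N] [ℓ.IsExpansionOn N]
    {g : U → N} (h : ∀ φ ∈ diagram ℓ U, φ.Realize g) (χ : L.Formula U) :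
    χ.Realize g ↔ χ.Realize (id : U → U) := by
  have key : ∀ χ : L.Formula U, χ.Realize (id : U → U) → χ.Realize g := fun χ hχ =>
    (LHom.realize_onFormula ℓ χ).1 (h _ ⟨χ, hχ, rfl⟩)
  refine ⟨fun hg => ?_, key χ⟩
  by_contra hid
  exact key χ.not (by simpa [Formula.realize_not] using hid) hg

/-- Finite satisfiability of the elementary diagram of `U` together with a set of formulas. -/
theorem satFormulas_diagram_union {S : Set (L'.Formula U)}
    (h : ∀ χ : L.Formula U, χ.Realize (id : U → U) →
      ∀ F : Set (L'.Formula U), F.Finite → F ⊆ S → SatFormulas (insert (ℓ.onFormula χ) F)) :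
    SatFormulas (diagram ℓ U ∪ S) := by
  refine satFormulas_of_finite fun F hF hFS => ?_
  have hfin : (F ∩ diagram ℓ U).Finite := hF.subset Set.inter_subset_left
  choose c hc hcF using fun x : ↥(F ∩ diagram ℓ U) => x.2.2
  have : Finite ↥(F ∩ diagram ℓ U) := hfin
  have hχ : (Formula.iInf c).Realize (id : U → U) :=
    Formula.realize_iInf.2 fun x => hc x
  obtain ⟨N, _, _, g, hg⟩ := (h _ hχ (F ∩ S) (hF.subset Set.inter_subset_left)
    Set.inter_subset_right).exists_realize
  refine SatFormulas.of_realize N g fun φ hφ => ?_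
  let _ : L.Structure N := ℓ.reduct N
  by_cases hd : φ ∈ diagram ℓ U
  · have h1 := (LHom.realize_onFormula ℓ _).1 (hg _ (Set.mem_insert _ _))
    have h2 := Formula.realize_iInf.1 h1 ⟨φ, hφ, hd⟩
    have h3 := (LHom.realize_onFormula ℓ _).2 h2
    rwa [hcF] at h3
  · exact hg _ (Set.mem_insert_of_mem _ ⟨hφ, (hFS hφ).resolve_left hd⟩)

variable (L' U) in
/-- An existential requirement: a formula in the last variable, with parameters in `U`. -/
abbrev Task : Type (max u' v' w) :=
  Σ m : ℕ, L'.BoundedFormula Empty (m + 1) × (Fin m → U)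

/-- The Henkin formula `∃ x φ(u, x) → φ(u, c)`. -/
def henkin (t : Task L' U) (c : U) : L'.Formula U :=
  Formula.imp
    (Formula.relabel (Sum.elim Empty.elim t.2.2) (BoundedFormula.toFormula t.2.1.ex))
    (Formula.relabel (Sum.elim Empty.elim (Fin.snoc t.2.2 c)) (BoundedFormula.toFormula t.2.1))

theorem realize_henkin {N : Type*} [L'.Structure N] (t : Task L' U) (c : U) (g : U → N) :
    (henkin t c).Realize g ↔
      ((∃ x, t.2.1.Realize default (Fin.snoc (g ∘ t.2.2) x : _ → N)) →
        t.2.1.Realize default (Fin.snoc (g ∘ t.2.2) (g c) : _ → N)) := by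
  rw [henkin, Formula.realize_imp, Formula.realize_relabel, Formula.realize_relabel,
    BoundedFormula.realize_toFormula, BoundedFormula.realize_toFormula,
    BoundedFormula.realize_ex]
  have h1 : (g ∘ Sum.elim Empty.elim t.2.2) ∘ Sum.inr = g ∘ t.2.2 := rfl
  have h2 : (g ∘ Sum.elim Empty.elim (Fin.snoc t.2.2 c : Fin (t.1 + 1) → U)) ∘ Sum.inr =
      (Fin.snoc (g ∘ t.2.2) (g c) : Fin (t.1 + 1) → N) := by
    rw [← Fin.comp_snoc]; rfl
  rw [h1, h2]
  simp only [Subsingleton.elim _ (default : Empty → N)]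

/-- By saturation, one Henkin witness can be added consistently. -/
theorem exists_henkin_witness (hU : IsSaturated L U) [Nonempty U] {A : Set U} (hA : #A < #U)
    {S : Set (L'.Formula U)} (hS : SupportedOn S A) (hsat : SatFormulas (diagram ℓ U ∪ S))
    (t : Task L' U) (ht : ∀ i, t.2.2 i ∈ A) :
    ∃ c, SatFormulas (diagram ℓ U ∪ (S ∪ {henkin t c})) := by
  obtain ⟨N, _, _, g, hg⟩ := hsat.exists_realize
  let _ : L.Structure N := ℓ.reduct N
  have hdiag := realize_iff_of_diagram (ℓ := ℓ) (g := g) fun φ hφ => hg φ (Or.inl hφ)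
  by_cases hw : ∃ x, t.2.1.Realize default (Fin.snoc (g ∘ t.2.2) x : _ → N)
  swap
  -- Without a witness in `N` the premise of the Henkin formula fails, so any `c` will do.
  · refine ⟨Classical.arbitrary U, SatFormulas.of_realize N g ?_⟩
    rintro φ (hφ | hφ | rfl)
    · exact hg φ (Or.inl hφ)
    · exact hg φ (Or.inr hφ)
    · exact (realize_henkin _ _ _).2 fun h => absurd h hw
  obtain ⟨x, hx⟩ := hw
  let f : A ⊕ Fin 1 → N := Sum.elim (fun a => g a) (fun _ => x)
  -- The L-type of `x` over `g '' A` is finitely satisfiable in `U` because `g` is elementary.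
  obtain ⟨y, hy⟩ := hU.exists_realize A hA 1 {ψ | ψ.Realize f} (by
    intro F hF hFp
    have : Finite F := hF
    let ψ : L.Formula (A ⊕ Fin 1) := Formula.iInf fun φ : F => φ.1
    have h1 : (ψ.iExs (Fin 1)).Realize fun a : A => g a :=
      Formula.realize_iExs.2 ⟨fun _ => x, Formula.realize_iInf.2 fun φ => hFp φ.2⟩
    have h2 := (hdiag ((ψ.iExs (Fin 1)).relabel ((↑) : A → U))).1
      (Formula.realize_relabel.2 h1)
    rw [Formula.realize_relabel, Formula.realize_iExs] at h2
    obtain ⟨y, hy⟩ := h2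
    exact ⟨y, fun φ hφ => Formula.realize_iInf.1 hy ⟨φ, hφ⟩⟩)
  have htype : ∀ ψ : L.Formula (A ⊕ Fin 1),
      ψ.Realize (Sum.elim (fun a : A => (a : U)) y) → ψ.Realize f := by
    intro ψ hψ
    by_contra hn
    exact hy ψ.not hn hψ
  -- Keep `g` on `A`, send `y 0` to `x`, and reassign the rest of `U` so that `χ` holds. Formulas of
  -- `S` see only `A`, so they remain true.
  refine ⟨y 0, satFormulas_diagram_union fun χ hχ F _ hFS => ?_⟩
  obtain ⟨g', hg', hχ'⟩ := exists_realize_extending htype χ hχ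
  have hgA : ∀ a ∈ A, g a = g' a := fun a ha => (hg' (Sum.inl ⟨a, ha⟩)).symm
  have hgy : g' (y 0) = x := hg' (Sum.inr 0)
  refine SatFormulas.of_realize N g' ?_
  rintro φ (rfl | hφ)
  · exact (LHom.realize_onFormula ℓ _).2 hχ'
  · rcases hFS hφ with hφS | rfl
    · exact hS φ hφS N g g' hgA (hg φ (Or.inr hφS))
    · refine (realize_henkin _ _ _).2 fun _ => ?_
      have : g' ∘ t.2.2 = g ∘ t.2.2 := funext fun i => (hgA _ (ht i)).symm
      rw [this, hgy]
      exact hx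

/-- Choice of a function by well-founded recursion, subject to conditions on its initial
segments. -/
theorem exists_forall_of_wellFounded {T : Type*} {V : Type*} [Nonempty V] {r : T → T → Prop}
    (hr : WellFounded r) (Q : T → (T → V) → V → Prop)
    (hcongr : ∀ t h h' c, (∀ t', r t' t → h t' = h' t') → Q t h c → Q t h' c)
    (hex : ∀ t h, (∀ t', r t' t → Q t' h (h t')) → ∃ c, Q t h c) :
    ∃ h : T → V, ∀ t, Q t h (h t) := by
  classical
  -- The value outside the predecessors of `t` is arbitrary: by `hcongr`, `Q t` ignores it.
  let ext : ∀ t, (∀ t', r t' t → V) → T → V := fun t ih t' =>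
    if h : r t' t then ih t' h else Classical.arbitrary V
  let h : T → V := hr.fix fun t ih => Classical.epsilon (Q t (ext t ih))
  refine ⟨h, fun t => ?_⟩
  induction t using hr.induction with
  | _ t ih =>
    have hext : ∀ t', r t' t → h t' = ext t (fun s _ => h s) t' := fun t' ht' => by
      simp only [ext, dif_pos ht']
    obtain ⟨c, hc⟩ := hex t h ih
    have := Classical.epsilon_spec (p := Q t (ext t fun s _ => h s))
      ⟨c, hcongr _ _ _ _ hext hc⟩
    have heq : h t = Classical.epsilon (Q t (ext t fun s _ => h s)) := hr.fix_eq _ _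
    rw [heq]
    exact hcongr _ _ _ _ (fun t' ht' => (hext t' ht').symm) this

/-- A task is coded by a formula and a finite list from `U`. The bound keeps the Henkin construction
to length at most |U|. -/
theorem lift_mk_task_le (hU : ℵ₀ ≤ #U)
    (hL : Cardinal.lift.{w} L'.card ≤ Cardinal.lift.{max u' v'} #U) :
    #(Task L' U) ≤ Cardinal.lift.{max u' v'} #U := by
  have hUl : ℵ₀ ≤ Cardinal.lift.{max u' v'} #U := by simpa using hU
  have : Infinite U := Cardinal.infinite_iff.2 hU
  let f : Task L' U → (Σ n, L'.BoundedFormula Empty n) × List U := fun t =>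
    (⟨t.1 + 1, t.2.1⟩, List.ofFn t.2.2)
  have hf : Function.Injective f := by
    rintro ⟨m, φ, u⟩ ⟨m', φ', u'⟩ h
    simp only [f, Prod.mk.injEq, Sigma.mk.injEq, add_left_inj] at h
    obtain ⟨⟨rfl, h1⟩, h2⟩ := h
    rw [heq_eq_eq] at h1
    rw [h1, List.ofFn_injective h2]
  refine (Cardinal.mk_le_of_injective hf).trans ?_
  rw [Cardinal.mk_prod, Cardinal.mk_list_eq_mk]
  refine (mul_le_mul' ?_ (le_refl _)).trans (Cardinal.mul_eq_self hUl).le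
  refine (Cardinal.lift_le.2 (BoundedFormula.card_le (L := L') (α := Empty))).trans ?_
  simp only [Cardinal.mk_eq_zero, Cardinal.lift_zero, zero_add, Cardinal.lift_max,
    Cardinal.lift_aleph0, Cardinal.lift_uzero]
  exact max_le hUl (by simpa using hL)

/-- The largest of the finitely many indices involved serves for all. The first alternative covers
the case where no index is involved, `I` being possibly empty. -/
theorem finite_subset_union_image {T X : Type*} [LinearOrder T] {I : Set T} {f : T → X}
    {Y F : Set X} (hF : F.Finite) (h : F ⊆ Y ∪ f '' I) :
    F ⊆ Y ∨ ∃ s ∈ I, F ⊆ Y ∪ f '' Set.Iic s := by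
  induction F, hF using Set.Finite.induction_on with
  | empty => exact Or.inl (Set.empty_subset _)
  | @insert a F _ _ ih =>
    rw [Set.insert_subset_iff] at h
    have hmono : ∀ s s', s ≤ s' → Y ∪ f '' Set.Iic s ⊆ Y ∪ f '' Set.Iic s' := fun s s' hs =>
      Set.union_subset_union_right _ (Set.image_mono (Set.Iic_subset_Iic.2 hs))
    rcases h.1 with ha | ⟨s, hs, rfl⟩ <;> rcases ih h.2 with hY | ⟨s', hs', hF⟩
    · exact Or.inl (Set.insert_subset ha hY)
    · exact Or.inr ⟨s', hs', Set.insert_subset (Or.inl ha) hF⟩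
    · exact Or.inr ⟨s, hs, Set.insert_subset (Or.inr ⟨s, le_refl s, rfl⟩)
        (hY.trans Set.subset_union_left)⟩
    · exact Or.inr ⟨max s s', by rcases max_choice s s' with h | h <;> rwa [h], Set.insert_subset
        (hmono s _ (le_max_left _ _) (Or.inr ⟨s, le_refl s, rfl⟩))
        (hF.trans (hmono s' _ (le_max_right _ _)))⟩

variable (L' U) in
/-- The `j`-th parameter among those of a task, and its chosen witness. -/
def taskParam (h : Task L' U → U) (t : Task L' U) : ℕ → U
  | 0 => h t
  | j + 1 => if hj : j < t.1 then t.2.2 ⟨j, hj⟩ else h t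

theorem supportedOn_henkin (h : Task L' U → U) (I : Set (Task L' U)) :
    SupportedOn ((fun t => henkin t (h t)) '' I)
      (Set.range fun x : I × ℕ => taskParam L' U h x.1 x.2) := by
  rintro _ ⟨t, ht, rfl⟩ N _ g g' hg
  have h0 : g (h t) = g' (h t) := hg _ ⟨(⟨t, ht⟩, 0), rfl⟩
  have h1 : g ∘ t.2.2 = g' ∘ t.2.2 := by
    funext i
    refine hg _ ⟨(⟨t, ht⟩, i + 1), ?_⟩
    simp [taskParam]
  simp only [realize_henkin, h0, h1, imp_self]

/-- A task contributes at most countably many elements, and |I|·ℵ₀ < |U| since U is uncountable. -/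
theorem mk_range_taskParam_lt (hκ : ℵ₀ < #U) (h : Task L' U → U) (I : Set (Task L' U))
    (hI : #I < Cardinal.lift.{max u' v'} #U) :
    #(Set.range fun x : I × ℕ => taskParam L' U h x.1 x.2) < #U := by
  rw [← Cardinal.lift_lt.{w, max u' v' w}]
  refine (Cardinal.mk_range_le_lift (f := fun x : I × ℕ => taskParam L' U h x.1 x.2)).trans_lt ?_
  simp only [Cardinal.mk_prod, Cardinal.lift_mul, Cardinal.lift_id', Cardinal.mk_nat,
    Cardinal.lift_aleph0]
  refine Cardinal.mul_lt_of_lt ?_ ?_ ?_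
  · simpa using hκ.le
  · rw [Cardinal.lift_id'.{w, max u' v'}]
    exact hI.trans_eq (Cardinal.lift_umax.{w, max u' v'}.symm ▸ rfl)
  · simpa using hκ

/-- A set of formulas over few parameters of the saturated structure `U`, consistent with the
elementary diagram of `U`, is realized in a model in which `U` contains all needed witnesses. -/
theorem exists_henkin_model (hU : IsSaturated L U) (hκ : ℵ₀ < #U)
    (hL : Cardinal.lift.{w} L'.card ≤ Cardinal.lift.{max u' v'} #U)
    {A : Set U} (hA : #A < #U) {S : Set (L'.Formula U)} (hS : SupportedOn S A)
    (hsat : SatFormulas (diagram ℓ U ∪ S)) :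
    ∃ (N : Type (max u' v' w)) (_ : L'.Structure N) (g : U → N),
      (∀ φ ∈ diagram ℓ U, φ.Realize g) ∧ (∀ φ ∈ S, φ.Realize g) ∧
      ∀ (m : ℕ) (φ : L'.BoundedFormula Empty (m + 1)) (u : Fin m → U) (x : N),
        φ.Realize default (Fin.snoc (g ∘ u) x : _ → N) →
          ∃ c, φ.Realize default (Fin.snoc (g ∘ u) (g c) : _ → N) := by
  have hne : Nonempty U := Cardinal.mk_ne_zero_iff.1 (Cardinal.aleph0_pos.trans hκ).ne'
  -- With a well-order of least possible type, fewer than |U| tasks precede any given one.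
  obtain ⟨_, _, hr⟩ := Cardinal.exists_ord_eq_type_lt (Task L' U)
  let Hk : (Task L' U → U) → Task L' U → L'.Formula U := fun h t => henkin t (h t)
  let Q : Task L' U → (Task L' U → U) → U → Prop := fun t h c =>
    SatFormulas (diagram ℓ U ∪ (S ∪ Hk h '' Set.Iio t ∪ {henkin t c}))
  have hIic : ∀ h t, Hk h '' Set.Iic t = Hk h '' Set.Iio t ∪ {henkin t (h t)} := fun h t => by
    rw [← Set.Iio_insert, Set.image_insert_eq, Set.union_singleton]
  have bounded : ∀ h (F : Set (L'.Formula U)), F.Finite → ∀ I,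
      F ⊆ diagram ℓ U ∪ S ∪ Hk h '' I → (∀ s ∈ I, Q s h (h s)) → SatFormulas F := by
    intro h F hF I hFt hQ
    rcases finite_subset_union_image hF hFt with hF' | ⟨s, hs, hF'⟩
    · exact hsat.mono hF'
    · refine (hQ s hs).mono ?_
      rw [hIic] at hF'
      simpa only [Set.union_assoc] using hF'
  obtain ⟨h, hh⟩ := exists_forall_of_wellFounded (r := (· < ·)) wellFounded_lt Q (by
    intro t h h' c hcongr hQ
    have : Hk h '' Set.Iio t = Hk h' '' Set.Iio t :=
      Set.image_congr fun s hs => by simp only [Hk, hcongr s hs]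
    simpa only [Q, this] using hQ) (by
    intro t h hQ
    have hI : #(Set.Iio t) < Cardinal.lift.{max u' v'} #U := by
      have := Cardinal.mk_Iio_lt t hr
      exact this.trans_le (lift_mk_task_le hκ.le hL)
    refine exists_henkin_witness hU (A := A ∪ (Set.range t.2.2 ∪
      Set.range fun x : Set.Iio t × ℕ => taskParam L' U h x.1 x.2)) ?_ ?_ ?_ t ?_
    · refine (Cardinal.mk_union_le _ _).trans_lt (Cardinal.add_lt_of_lt hκ.le hA
        ((Cardinal.mk_union_le _ _).trans_lt (Cardinal.add_lt_of_lt hκ.le ?_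
          (mk_range_taskParam_lt hκ h _ hI))))
      exact (Cardinal.lt_aleph0_iff_set_finite.2 (Set.finite_range _)).trans hκ
    · rintro φ (hφ | hφ)
      · exact hS.mono Set.subset_union_left φ hφ
      · exact (supportedOn_henkin h _).mono
          (Set.subset_union_right.trans Set.subset_union_right) φ hφ
    · exact satFormulas_of_finite fun F hF hFS =>
        bounded h F hF (Set.Iio t) (by simpa only [Set.union_assoc] using hFS) hQ
    · exact fun i => Or.inr (Or.inl ⟨i, rfl⟩))
  have hall : SatFormulas (diagram ℓ U ∪ S ∪ Set.range (Hk h)) := by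
    rw [← Set.image_univ]
    exact satFormulas_of_finite fun F hF hFS => bounded h F hF Set.univ hFS fun s _ => hh s
  obtain ⟨N, iN, _, g, hg⟩ := hall.exists_realize
  refine ⟨N, iN, g, fun φ hφ => hg φ (Or.inl (Or.inl hφ)),
    fun φ hφ => hg φ (Or.inl (Or.inr hφ)), fun m φ u x hx => ⟨h ⟨m, φ, u⟩, ?_⟩⟩
  exact (realize_henkin ⟨m, φ, u⟩ _ g).1 (hg _ (Or.inr ⟨_, rfl⟩)) ⟨x, hx⟩

end Resplendence

/-! ### Expansions by a predicate and members of e(D) -/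

section Expansion

variable {L : FirstOrder.Language.{u, v}} {U : Type w} [L.Structure U] {n : ℕ}

theorem expansion_isExpansionOn (D : Set (Fin n → U)) :
    letI := expansion L D
    (LHom.sumInl : L →ᴸ L.sum (predLanguage n)).IsExpansionOn U :=
  letI := expansion L D
  ⟨fun _ _ => rfl, fun _ _ => rfl⟩

variable (L n) in
/-- The new predicate of the expanded language. -/
abbrev predSymbol : (L.sum (predLanguage n)).Relations n := Sum.inr PredRel.mem

variable (L) in
/-- The atomic formula saying that the tuple of variables `z` belongs to the predicate. -/
def memFormula {α : Type*} (z : Fin n → α) : (L.sum (predLanguage n)).Formula α :=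
  (predSymbol L n).formula fun i => Term.var (z i)

theorem realize_memFormula {α N : Type*} [(L.sum (predLanguage n)).Structure N] (z : Fin n → α)
    (g : α → N) :
    (memFormula L z).Realize g ↔ Structure.RelMap (predSymbol L n) (g ∘ z) := by
  rw [memFormula, Formula.realize_rel]
  rfl

theorem realize_memFormula_expansion {α : Type*} (D : Set (Fin n → U)) (z : Fin n → α)
    (g : α → U) :
    letI := expansion L D
    (memFormula L z).Realize g ↔ g ∘ z ∈ D :=
  letI := expansion L D
  realize_memFormula z g

theorem realize_relabel_sentence {L' : FirstOrder.Language} {α N : Type*} [L'.Structure N]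
    (σ : L'.Sentence) (g : α → N) :
    (Formula.relabel (Empty.elim : Empty → α) σ).Realize g ↔ N ⊨ σ := by
  rw [Formula.realize_relabel, Sentence.Realize, Subsingleton.elim (g ∘ Empty.elim) default]

/-- If `U` embeds in a model of the theory of `⟨U, D⟩` that is an elementary extension of `U` and in
which `U` satisfies the Tarski–Vaught test, then the trace of the predicate on `U` is in `e(D)`. -/
theorem preimage_mem_eClass {D : Set (Fin n → U)} {N : Type*}
    [(L.sum (predLanguage n)).Structure N] (g : U → N)
    (hdiag : ∀ φ ∈ diagram (LHom.sumInl : L →ᴸ L.sum (predLanguage n)) U, φ.Realize g)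
    (hT : ∀ σ : (L.sum (predLanguage n)).Sentence,
      (letI := expansion L D; σ.Realize U) → σ.Realize N)
    (hTV : ∀ (m : ℕ) (φ : (L.sum (predLanguage n)).BoundedFormula Empty (m + 1)) (u : Fin m → U)
      (x : N), φ.Realize default (Fin.snoc (g ∘ u) x : _ → N) →
        ∃ c, φ.Realize default (Fin.snoc (g ∘ u) (g c) : _ → N)) :
    {z : Fin n → U | Structure.RelMap (predSymbol L n) (g ∘ z)} ∈ eClass L D := by
  set C : Set (Fin n → U) := {z | Structure.RelMap (predSymbol L n) (g ∘ z)} with hC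
  let iL : L.Structure N := (LHom.sumInl : L →ᴸ L.sum (predLanguage n)).reduct N
  have hd := realize_iff_of_diagram (ℓ := (LHom.sumInl : L →ᴸ L.sum (predLanguage n))) hdiag
  have hinj : Function.Injective g := fun a b hab => by
    have := (hd ((Term.var a).equal (Term.var b))).1 (by simpa [Formula.realize_equal] using hab)
    simpa [Formula.realize_equal] using this
  have hfun : ∀ {m : ℕ} (f : L.Functions m) (x : Fin m → U),
      g (Structure.funMap f x) = Structure.funMap f (g ∘ x) := by
    intro m f x
    have := (hd ((Term.var (Structure.funMap f x)).equal
      (Term.func f fun i => Term.var (x i)))).2 (by simp [Formula.realize_equal])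
    simpa [Formula.realize_equal, Function.comp_def] using this
  have hrel : ∀ {m : ℕ} (R : L.Relations m) (x : Fin m → U),
      Structure.RelMap R (g ∘ x) ↔ Structure.RelMap R x := by
    intro m R x
    have := hd (R.formula fun i => Term.var (x i))
    rw [Formula.realize_rel, Formula.realize_rel] at this
    exact this
  let _ := expansion L C
  let e : U ↪[L.sum (predLanguage n)] N :=
    { toFun := g
      inj' := hinj
      map_fun' := by
        rintro m (f | f) x
        · exact hfun f x
        · exact f.elim
      map_rel' := by
        rintro m (R | R) x
        · exact hrel R x
        · cases R
          exact Iff.rfl }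
  -- With the predicate read as `C`, `g` is an embedding of expanded structures that passes the
  -- Tarski–Vaught test, hence is elementary.
  have hCN : ∀ σ : (L.sum (predLanguage n)).Sentence, σ.Realize U ↔ σ.Realize N := fun σ =>
    (e.toElementaryEmbedding hTV).elementarilyEquivalent.realize_sentence σ
  have hDC : ∀ σ : (L.sum (predLanguage n)).Sentence,
      (letI := expansion L D; σ.Realize U) → σ.Realize U := fun σ hσ => (hCN σ).2 (hT σ hσ)
  have : ∀ σ : (L.sum (predLanguage n)).Sentence,
      σ.Realize U ↔ (letI := expansion L D; σ.Realize U) := by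
    refine fun σ => ⟨fun h => ?_, hDC σ⟩
    by_contra hn
    exact hDC (Formula.not σ) hn h
  exact Set.ext this

theorem card_sum_predLanguage_le {κ : Cardinal.{w}} (hκ : ℵ₀ < κ)
    (hL : Cardinal.lift.{w} L.card < Cardinal.lift.{max u v} κ) :
    Cardinal.lift.{w} (L.sum (predLanguage n)).card ≤ Cardinal.lift.{max u v} κ := by
  have hpred : (predLanguage n).card ≤ 1 := by
    rw [Language.card, Cardinal.le_one_iff_subsingleton]
    refine ⟨?_⟩
    rintro (⟨_, ⟨⟩⟩ | ⟨_, ⟨⟩⟩) (⟨_, ⟨⟩⟩ | ⟨_, ⟨⟩⟩)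
    rfl
  have hκl : ℵ₀ < Cardinal.lift.{max u v} κ := by simpa using hκ
  rw [Language.card_sum, Cardinal.lift_add]
  refine Cardinal.add_le_of_le hκl.le ?_ ?_
  · simpa using hL.le
  · refine le_trans ?_ hκl.le
    simpa using hpred.trans Cardinal.one_le_aleph0

/-- Resplendence: a trace on finitely many tuples of the saturated structure `U` is the trace of
some member of `e(D)`, if this is finitely consistent. -/
theorem exists_mem_eClass_trace (hU : IsSaturated L U) (hκ : ℵ₀ < #U)
    (hL : Cardinal.lift.{w} L.card < Cardinal.lift.{max u v} #U) (D : Set (Fin n → U))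
    {k : ℕ} (c : Fin k → Fin n → U) (S : Set (Fin k))
    (h : ∀ χ : L.Formula U, χ.Realize (id : U → U) →
      ∃ g : U → U, χ.Realize g ∧ ∀ i, g ∘ c i ∈ D ↔ i ∈ S) :
    ∃ C ∈ eClass L D, ∀ i, c i ∈ C ↔ i ∈ S := by
  classical
  have hne : Nonempty U := Cardinal.mk_ne_zero_iff.1 (Cardinal.aleph0_pos.trans hκ).ne'
  let Γ : Set ((L.sum (predLanguage n)).Formula U) :=
    Formula.relabel Empty.elim '' {σ : (L.sum (predLanguage n)).Sentence |
      letI := expansion L D; σ.Realize U} ∪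
    Set.range fun i => if i ∈ S then memFormula L (c i) else (memFormula L (c i)).not
  have hΓ : SupportedOn Γ (Set.range (Function.uncurry c)) := by
    rintro φ (⟨σ, -, rfl⟩ | ⟨i, rfl⟩) N _ g g' hg hφ
    · rwa [realize_relabel_sentence] at hφ ⊢
    · have : g ∘ c i = g' ∘ c i := funext fun j => hg _ ⟨(i, j), rfl⟩
      dsimp only at hφ ⊢
      split_ifs at hφ ⊢
      · rwa [realize_memFormula, ← this, ← realize_memFormula]
      · rwa [Formula.realize_not, realize_memFormula, ← this, ← realize_memFormula,
          ← Formula.realize_not]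
  -- Each finite part is satisfied in ⟨U,D⟩ itself, under the moved assignment `g` supplied by `h`.
  have hsat : SatFormulas (diagram (LHom.sumInl : L →ᴸ L.sum (predLanguage n)) U ∪ Γ) := by
    refine satFormulas_diagram_union fun χ hχ F _ hF => ?_
    obtain ⟨g, hg, hS⟩ := h χ hχ
    let _ := expansion L D
    have := expansion_isExpansionOn (L := L) D
    refine SatFormulas.of_realize U g ?_
    rintro φ (rfl | hφ)
    · exact (LHom.realize_onFormula _ _).2 hg
    · rcases hF hφ with ⟨σ, hσ, rfl⟩ | ⟨i, rfl⟩
      · exact (realize_relabel_sentence _ _).2 hσ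
      · dsimp only
        split_ifs with hi
        · exact (realize_memFormula_expansion D _ _).2 ((hS i).2 hi)
        · exact fun hm => hi ((hS i).1 ((realize_memFormula_expansion D _ _).1 hm))
  obtain ⟨N, _, g, hdiag, hΓN, hTV⟩ := exists_henkin_model hU hκ
    (card_sum_predLanguage_le hκ hL) (A := Set.range (Function.uncurry c))
    ((Cardinal.lt_aleph0_iff_set_finite.2 (Set.finite_range _)).trans hκ) hΓ hsat
  refine ⟨_, preimage_mem_eClass g hdiag (fun σ hσ => ?_) hTV, fun i => ?_⟩
  · exact (realize_relabel_sentence _ _).1 (hΓN _ (Or.inl ⟨σ, hσ, rfl⟩))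
  · have := hΓN _ (Or.inr ⟨i, rfl⟩)
    dsimp only at this
    split_ifs at this with hi
    · exact iff_of_true ((realize_memFormula _ _).1 this) hi
    · exact iff_of_false (fun hm => this ((realize_memFormula _ _).2 hm)) hi

end Expansion

/-! ### The ideal of uniformly covered sets -/

section LowerApproximation

variable {L : FirstOrder.Language.{u, v}} {U : Type w} [L.Structure U] {n : ℕ}

variable (L) in
/-- A set `X` of tuples is uniformly covered inside `D` if some formula `φ(x, z)` has, for every
finite `F ⊆ X`, an instance that covers `F` and is contained in `D`. -/
def UniformlyCovered (D X : Set (Fin n → U)) : Prop :=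
  ∃ (m : ℕ) (φ : L.Formula (Fin m ⊕ Fin n)), ∀ F : Set (Fin n → U), F.Finite → F ⊆ X →
    ∃ b : Fin m → U, F ⊆ fiber φ b ∧ fiber φ b ⊆ D

/-- Only finitely many variables of `γ` occur in `φ`, so they can be renumbered. This allows
elements of `U` to serve as parameter variables. -/
theorem UniformlyCovered.of_formula {γ : Type*} {D X : Set (Fin n → U)}
    (φ : L.Formula (γ ⊕ Fin n))
    (h : ∀ F : Set (Fin n → U), F.Finite → F ⊆ X → ∃ b : γ → U,
      (∀ z ∈ F, φ.Realize (Sum.elim b z)) ∧ ∀ z, φ.Realize (Sum.elim b z) → z ∈ D) :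
    UniformlyCovered L D X := by
  classical
  let s : Set γ := Sum.inl ⁻¹' (φ.freeVarFinset : Set (γ ⊕ Fin n))
  have : Finite s := (φ.freeVarFinset.finite_toSet.preimage Sum.inl_injective.injOn)
  let e := Finite.equivFin s
  let k : φ.freeVarFinset → Fin (Nat.card s) ⊕ Fin n := fun x =>
    match x with
    | ⟨Sum.inl a, ha⟩ => Sum.inl (e ⟨a, ha⟩)
    | ⟨Sum.inr j, _⟩ => Sum.inr j
  have key : ∀ (b : γ → U) (z : Fin n → U),
      Formula.Realize (φ.restrictFreeVar k) (Sum.elim (fun i => b (e.symm i)) z) ↔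
        φ.Realize (Sum.elim b z) := by
    intro b z
    refine BoundedFormula.realize_restrictFreeVar (φ := φ) (f := k)
      (v := Sum.elim (fun i => b (e.symm i)) z) (Sum.elim b z) ?_
    rintro ⟨a | j, ha⟩
    · exact congrArg b (congrArg Subtype.val (e.symm_apply_apply ⟨a, ha⟩))
    · rfl
  refine ⟨Nat.card s, φ.restrictFreeVar k, fun F hF hFX => ?_⟩
  obtain ⟨b, hb, hbD⟩ := h F hF hFX
  exact ⟨fun i => b (e.symm i), fun z hz => (key b z).2 (hb z hz),
    fun z hz => hbD z ((key b z).1 hz)⟩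

theorem UniformlyCovered.mono {D X Y : Set (Fin n → U)} (h : UniformlyCovered L D X)
    (hY : Y ⊆ X) : UniformlyCovered L D Y := by
  obtain ⟨m, φ, h⟩ := h
  exact ⟨m, φ, fun F hF hFY => h F hF (hFY.trans hY)⟩

/-- Take the disjunction of the two formulas, with separate parameter tuples. -/
theorem UniformlyCovered.union {D X Y : Set (Fin n → U)}
    (hX : UniformlyCovered L D X) (hY : UniformlyCovered L D Y) :
    UniformlyCovered L D (X ∪ Y) := by
  obtain ⟨m, φ, hφ⟩ := hX
  obtain ⟨m', ψ, hψ⟩ := hY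
  refine .of_formula (γ := Fin m ⊕ Fin m') (φ.relabel (Sum.map Sum.inl id) ⊔
    ψ.relabel (Sum.map Sum.inr id)) fun F hF hFXY => ?_
  obtain ⟨b, hb, hbD⟩ := hφ (F ∩ X) (hF.inter_of_left _) Set.inter_subset_right
  obtain ⟨b', hb', hbD'⟩ := hψ (F ∩ Y) (hF.inter_of_left _) Set.inter_subset_right
  have key : ∀ z, (φ.relabel (Sum.map Sum.inl id) ⊔ ψ.relabel (Sum.map Sum.inr id) :
      L.Formula ((Fin m ⊕ Fin m') ⊕ Fin n)).Realize (Sum.elim (Sum.elim b b') z) ↔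
      z ∈ fiber φ b ∨ z ∈ fiber ψ b' := by
    intro z
    rw [Formula.realize_sup, Formula.realize_relabel, Formula.realize_relabel,
      Sum.elim_comp_map, Sum.elim_comp_map]
    rfl
  refine ⟨Sum.elim b b', fun z hz => (key z).2 ?_, fun z hz => ?_⟩
  · exact (hFXY hz).imp (fun h => hb ⟨hz, h⟩) fun h => hb' ⟨hz, h⟩
  · exact ((key z).1 hz).elim (fun h => hbD h) fun h => hbD' h

theorem UniformlyCovered.approximableFromBelow {D : Set (Fin n → U)}
    (h : UniformlyCovered L D D) : ApproximableFromBelow L D := by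
  obtain ⟨m, φ, h⟩ := h
  refine ⟨m, φ, fun B hB => ?_⟩
  have hcube : (cube B n).Finite := by
    refine (Set.Finite.pi' fun _ : Fin n => hB).subset fun z hz => ?_
    exact hz
  obtain ⟨b, hb, hbD⟩ := h (D ∩ cube B n) (hcube.inter_of_right _) Set.inter_subset_left
  exact ⟨b, Set.Subset.antisymm (Set.inter_subset_inter_left _ hbD)
    (Set.subset_inter hb Set.inter_subset_right), hbD⟩

/-- If `D` is not uniformly covered, some ultrafilter on `D` contains no uniformly covered set. -/
theorem exists_ultrafilter_not_uniformlyCovered {D : Set (Fin n → U)}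
    (h : ¬ UniformlyCovered L D D) :
    ∃ W : Ultrafilter (Fin n → U), D ∈ W ∧ ∀ X ∈ W, ¬ UniformlyCovered L D X := by
  -- The filter dual, relative to `D`, to the ideal of covered sets.
  let l : Filter (Fin n → U) :=
    { sets := {X | UniformlyCovered L D (D \ X)}
      univ_sets := by
        refine .of_formula (γ := Empty) (⊥ : L.Formula _) fun F _ hF => ⟨Empty.elim, fun z hz => ?_,
          fun z hz => hz.elim⟩
        exact absurd (Set.mem_univ z) (hF hz).2
      sets_of_superset := fun hX hXY => UniformlyCovered.mono hX (Set.sdiff_subset_sdiff_right hXY)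
      inter_sets := fun hX hY => by
        rw [Set.mem_ofPred_eq, Set.sdiff_inter]
        exact UniformlyCovered.union hX hY }
  have hl : l.NeBot := by
    refine ⟨fun hbot => h ?_⟩
    have : (∅ : Set (Fin n → U)) ∈ l := by rw [hbot]; trivial
    simpa using (show UniformlyCovered L D (D \ ∅) from this)
  have hDl : D ∈ l := by
    refine UniformlyCovered.mono (X := D \ Set.univ) l.univ_sets ?_
    simp
  refine ⟨Ultrafilter.of l, Ultrafilter.of_le l hDl, fun X hX hcov => ?_⟩
  have hc : Xᶜ ∈ l := hcov.mono (by intro z hz; simpa using hz.2)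
  exact Ultrafilter.compl_notMem_iff.2 hX (Ultrafilter.of_le l hc)

/-! ### Iterated powers of an ultrafilter and patterns of membership -/

/-- Membership of `R` in the iterated power of an ultrafilter. -/
def IterMem {Z : Type*} (W : Ultrafilter Z) : ∀ m : ℕ, Set (Fin m → Z) → Prop
  | 0, R => (Fin.elim0 : Fin 0 → Z) ∈ R
  | m + 1, R => ∀ᶠ a in (W : Filter Z), IterMem W m {s | (Fin.snoc s a : Fin (m + 1) → Z) ∈ R}

theorem IterMem.mono {Z : Type*} {W : Ultrafilter Z} {m : ℕ} {R R' : Set (Fin m → Z)}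
    (h : IterMem W m R) (hR : R ⊆ R') : IterMem W m R' := by
  induction m with
  | zero => exact hR h
  | succ m ih => exact Filter.Eventually.mono h fun a ha => ih ha fun s hs => hR hs

theorem iterMem_iInter {Z ι : Type*} [Finite ι] {W : Ultrafilter Z} {m : ℕ}
    {R : ι → Set (Fin m → Z)} (h : ∀ i, IterMem W m (R i)) : IterMem W m (⋂ i, R i) := by
  induction m with
  | zero => exact Set.mem_iInter.2 h
  | succ m ih =>
    refine (Filter.eventually_all.2 h).mono fun a ha => (ih ha).mono ?_
    intro s hs
    simpa using hs

/-- Ultrafilter quantifiers commute with negation, one coordinate at a time; hence the formulas true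
on large sets form a complete type. -/
theorem iterMem_compl {Z : Type*} {W : Ultrafilter Z} {m : ℕ} {R : Set (Fin m → Z)} :
    IterMem W m Rᶜ ↔ ¬ IterMem W m R := by
  induction m with
  | zero => exact Iff.rfl
  | succ m ih =>
    rw [IterMem, IterMem, ← Ultrafilter.eventually_not]
    exact Filter.eventually_congr (Filter.Eventually.of_forall fun a => ih)

/-- The set of `m`-tuples of `n`-tuples defined by a formula with parameters in `U`. -/
def paramSet {m : ℕ} (ψ : L.Formula (U ⊕ (Fin m × Fin n))) : Set (Fin m → Fin n → U) :=
  {s | ψ.Realize (Sum.elim id (Function.uncurry s))}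

/-- Renaming of variables that substitutes parameters for the last tuple. -/
def lastToParam {m : ℕ} (a : Fin n → U) : U ⊕ (Fin (m + 1) × Fin n) → U ⊕ (Fin m × Fin n)
  | Sum.inl c => Sum.inl c
  | Sum.inr (i, j) => Fin.lastCases (motive := fun _ => U ⊕ (Fin m × Fin n))
      (Sum.inl (a j)) (fun i => Sum.inr (i, j)) i

theorem paramSet_relabel_lastToParam {m : ℕ} (a : Fin n → U)
    (ψ : L.Formula (U ⊕ (Fin (m + 1) × Fin n))) :
    paramSet (ψ.relabel (lastToParam a)) =
      {s | (Fin.snoc s a : Fin (m + 1) → Fin n → U) ∈ paramSet ψ} := by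
  ext s
  simp only [paramSet, Set.mem_ofPred_eq, Formula.realize_relabel]
  have : Sum.elim id (Function.uncurry s) ∘ lastToParam a =
      Sum.elim id (Function.uncurry (Fin.snoc s a : Fin (m + 1) → Fin n → U)) := by
    funext x
    rcases x with c | ⟨i, j⟩
    · rfl
    · induction i using Fin.lastCases <;> simp [lastToParam, Function.uncurry]
  rw [this]

/-- A definable set in the iterated power of `W` realizes every pattern of membership in `D`. -/
theorem exists_mem_paramSet_pattern {D : Set (Fin n → U)}
    {W : Ultrafilter (Fin n → U)} (hD : D ∈ W) (hW : ∀ X ∈ W, ¬ UniformlyCovered L D X)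
    {m : ℕ} (ψ : L.Formula (U ⊕ (Fin m × Fin n))) (hψ : IterMem W m (paramSet ψ))
    (S : Fin m → Prop) : ∃ b ∈ paramSet ψ, ∀ i, b i ∈ D ↔ S i := by
  induction m with
  | zero => exact ⟨_, hψ, fun i => i.elim0⟩
  | succ m ih =>
    have hlast : ∀ b : Fin m → Fin n → U, ∀ a, (∀ i, b i ∈ D ↔ S i.castSucc) →
        (a ∈ D ↔ S (Fin.last m)) →
        ∀ i, (Fin.snoc b a : Fin (m + 1) → Fin n → U) i ∈ D ↔ S i := by
      intro b a hb ha i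
      induction i using Fin.lastCases with
      | last => simpa using ha
      | cast i => simpa using hb i
    by_cases hS : S (Fin.last m)
    -- The last coordinate is quantified outermost: fix a good `a` in `D` and treat it as a
    -- parameter.
    · obtain ⟨a, ha, haD⟩ := (Filter.Eventually.and hψ hD).exists
      rw [← paramSet_relabel_lastToParam] at ha
      obtain ⟨b, hb, hbS⟩ := ih _ ha fun i => S i.castSucc
      rw [paramSet_relabel_lastToParam] at hb
      exact ⟨_, hb, hlast b a hbS (iff_of_true haD hS)⟩
    -- If no point outside `D` completes the pattern, every `b` with the right pattern has its whole
    -- ψ-fibre inside `D`. Such fibres then uniformly cover the W-large set of good `a`, against the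
    -- choice of `W`.
    · by_contra! hno
      have hin : ∀ b : Fin m → Fin n → U, (∀ i, b i ∈ D ↔ S i.castSucc) → ∀ a,
          (Fin.snoc b a : Fin (m + 1) → Fin n → U) ∈ paramSet ψ → a ∈ D := by
        intro b hb a ha
        by_contra haD
        obtain ⟨i, hi⟩ := hno _ ha
        have := hlast b a hb (iff_of_false haD hS) i
        tauto
      refine hW _ hψ ?_
      let θ : L.Formula ((U ⊕ (Fin m × Fin n)) ⊕ Fin n) := ψ.relabel fun x =>
        match x with
        | Sum.inl c => Sum.inl (Sum.inl c)
        | Sum.inr (i, j) => Fin.lastCases (motive := fun _ => (U ⊕ (Fin m × Fin n)) ⊕ Fin n)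
            (Sum.inr j) (fun i => Sum.inl (Sum.inr (i, j))) i
      have hθ : ∀ (b : Fin m → Fin n → U) (z : Fin n → U),
          θ.Realize (Sum.elim (Sum.elim id (Function.uncurry b)) z) ↔
            (Fin.snoc b z : Fin (m + 1) → Fin n → U) ∈ paramSet ψ := by
        intro b z
        simp only [θ, Formula.realize_relabel, paramSet, Set.mem_ofPred_eq]
        refine iff_of_eq (congrArg _ (funext fun x => ?_))
        rcases x with c | ⟨i, j⟩
        · rfl
        · induction i using Fin.lastCases <;> simp [Function.uncurry]
      refine .of_formula θ fun F hF hFX => ?_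
      have : Finite F := hF
      let ψ' : L.Formula (U ⊕ (Fin m × Fin n)) :=
        Formula.iInf fun a : F => ψ.relabel (lastToParam a.1)
      have hψ' : paramSet ψ' = ⋂ a : F, paramSet (ψ.relabel (lastToParam a.1)) := by
        ext s
        simp [paramSet, ψ', Formula.realize_iInf]
      -- The fibres over the finitely many `a ∈ F` have a large intersection, so one `b` with the
      -- right pattern serves all of `F`.
      obtain ⟨b, hb, hbS⟩ := ih ψ' (by
        rw [hψ']
        refine iterMem_iInter fun a => ?_
        rw [paramSet_relabel_lastToParam]
        exact hFX a.2) fun i => S i.castSucc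
      rw [hψ', Set.mem_iInter] at hb
      refine ⟨_, fun z hz => (hθ b z).2 ?_, fun z hz => hin b hbS z ((hθ b z).1 hz)⟩
      have := hb ⟨z, hz⟩
      rwa [paramSet_relabel_lastToParam] at this

end LowerApproximation

/-! ### From finite VC-dimension to approximability -/

section Main

variable {L : FirstOrder.Language.{u, v}} {U : Type w} [L.Structure U] {n : ℕ}

theorem IterMem.nonempty {Z : Type*} {W : Ultrafilter Z} {m : ℕ} {R : Set (Fin m → Z)}
    (h : IterMem W m R) : R.Nonempty := by
  induction m with
  | zero => exact ⟨_, h⟩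
  | succ m ih =>
    obtain ⟨a, ha⟩ := Filter.Eventually.exists h
    obtain ⟨s, hs⟩ := ih ha
    exact ⟨_, hs⟩

/-- A saturated structure realizes the type over `∅` of the iterated power of an ultrafilter. -/
theorem exists_realize_iterMem (hU : IsSaturated L U) [Nonempty U] (W : Ultrafilter (Fin n → U))
    (k : ℕ) :
    ∃ c : Fin k → Fin n → U, ∀ ψ : L.Formula (Fin k × Fin n), ψ.Realize (Function.uncurry c) →
      IterMem W k {s | ψ.Realize (Function.uncurry s)} := by
  let e : Fin k × Fin n ≃ Fin (k * n) := finProdFinEquiv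
  let tuple : (Fin k → Fin n → U) → ↥(∅ : Set U) ⊕ Fin (k * n) → U := fun s =>
    Sum.elim (↑) (Function.uncurry s ∘ e.symm)
  -- Finitely many large sets have a common element, so the type is finitely satisfiable.
  obtain ⟨v, hv⟩ := hU.exists_realize ∅ (by
    rw [Cardinal.mk_eq_zero]; exact pos_iff_ne_zero.2 (Cardinal.mk_ne_zero U)) (k * n)
    {φ | IterMem W k {s | φ.Realize (tuple s)}} (by
      intro F hF hFp
      have : Finite F := hF
      obtain ⟨s, hs⟩ := (iterMem_iInter fun φ : F => hFp φ.2).nonempty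
      rw [Set.mem_iInter] at hs
      exact ⟨_, fun φ hφ => hs ⟨φ, hφ⟩⟩)
  refine ⟨fun i j => v (e (i, j)), fun ψ hψ => ?_⟩
  by_contra hn
  rw [← iterMem_compl] at hn
  have hrel : ∀ s : Fin k → Fin n → U,
      (ψ.not.relabel fun x => (Sum.inr (e x) : ↥(∅ : Set U) ⊕ Fin (k * n))).Realize (tuple s) ↔
        ¬ ψ.Realize (Function.uncurry s) := by
    intro s
    rw [Formula.realize_relabel, Formula.realize_not]
    have : tuple s ∘ (fun x => Sum.inr (e x)) = Function.uncurry s := by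
      funext x; simp [tuple]
    rw [this]
  have := hv (ψ.not.relabel fun x => Sum.inr (e x)) (hn.mono fun s hs => (hrel s).2 hs)
  rw [Formula.realize_relabel, Formula.realize_not] at this
  exact this hψ

/-- If `e(D)` has finite VC-dimension, then `D` is approximable from below. -/
theorem approximableFromBelow_of_finiteVCDim (hU : IsSaturated L U) (hκ : ℵ₀ < #U)
    (hL : Cardinal.lift.{w} L.card < Cardinal.lift.{max u v} #U) {D : Set (Fin n → U)}
    (hD : FiniteVCDim (eClass L D)) : ApproximableFromBelow L D := by
  classical
  refine UniformlyCovered.approximableFromBelow ?_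
  by_contra hcov
  have hne : Nonempty U := Cardinal.mk_ne_zero_iff.1 (Cardinal.aleph0_pos.trans hκ).ne'
  obtain ⟨W, hDW, hW⟩ := exists_ultrafilter_not_uniformlyCovered hcov
  obtain ⟨k, hk⟩ := hD
  obtain ⟨c, hc⟩ := exists_realize_iterMem (L := L) hU W k
  have hS : ∀ S : Set (Fin k), ∃ C ∈ eClass L D, ∀ i, c i ∈ C ↔ i ∈ S := by
    refine fun S => exists_mem_eClass_trace hU hκ hL D c S fun χ hχ => ?_
    -- Since `ψ` is true of `c`, its solution set is large and contains a tuple `b` of pattern `S`;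
    -- then `c i ↦ b i` extends to an assignment satisfying `χ`.
    obtain ⟨ψ, hψ, hext⟩ := exists_formula_extending_of_finite (N := U) (Function.uncurry c) χ hχ
    have hset : paramSet (ψ.relabel Sum.inr : L.Formula (U ⊕ (Fin k × Fin n))) =
        {s | ψ.Realize (Function.uncurry s)} := by
      ext s
      simp only [paramSet, Set.mem_ofPred_eq, Formula.realize_relabel]
      rfl
    obtain ⟨b, hb, hbS⟩ := exists_mem_paramSet_pattern hDW hW (ψ.relabel Sum.inr)
      (by rw [hset]; exact hc ψ hψ) (· ∈ S)
    rw [hset] at hb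
    obtain ⟨g, hg, hχg⟩ := hext _ hb
    refine ⟨g, hχg, fun i => ?_⟩
    have : g ∘ c i = b i := funext fun j => hg (i, j)
    rw [this]
    exact hbS i
  -- Traces {i} separate the points, so `c` does list `k` distinct ones.
  have hinj : Function.Injective c := by
    intro i j hij
    obtain ⟨C, -, hC⟩ := hS {i}
    exact ((hC j).1 (hij ▸ (hC i).2 rfl)).symm
  refine hk (Finset.univ.image c) ?_ fun H hH => ?_
  · rw [Finset.card_image_of_injective _ hinj, Finset.card_univ, Fintype.card_fin]
  · obtain ⟨C, hC, hCS⟩ := hS {i | c i ∈ H}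
    refine ⟨C, hC, Set.ext fun z => ⟨?_, fun hz => ?_⟩⟩
    · rintro ⟨hzC, hz⟩
      obtain ⟨i, -, rfl⟩ := Finset.mem_image.1 (Finset.mem_coe.1 hz)
      exact (hCS i).1 hzC
    · obtain ⟨i, -, rfl⟩ := Finset.mem_image.1 (Finset.mem_coe.1 (hH hz))
      exact ⟨(hCS i).2 hz, hH hz⟩

/-! ### Finite traces, NIP and external definability -/

/-- The sentence saying that the traces of the predicate on `k` tuples are traces of `φ`. -/
noncomputable def traceSentence {m : ℕ} (φ : L.Formula (Fin m ⊕ Fin n)) (k : ℕ) :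
    (L.sum (predLanguage n)).Sentence :=
  Formula.iAlls (Fin k × Fin n) (Formula.iExs (Fin m) (Formula.iInf fun i : Fin k =>
    Formula.iff
      (((LHom.sumInl : L →ᴸ L.sum (predLanguage n)).onFormula φ).relabel
        (Sum.elim Sum.inr fun j => Sum.inl (Sum.inr (i, j))))
      (memFormula L fun j => (Sum.inl (Sum.inr (i, j)) : (Empty ⊕ (Fin k × Fin n)) ⊕ Fin m))))

theorem realize_traceSentence {m : ℕ} (φ : L.Formula (Fin m ⊕ Fin n)) (k : ℕ)
    (D : Set (Fin n → U)) :
    (letI := expansion L D; U ⊨ traceSentence φ k) ↔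
      ∀ z : Fin k → Fin n → U, ∃ b : Fin m → U, ∀ i, z i ∈ fiber φ b ↔ z i ∈ D := by
  let _ := expansion L D
  have := expansion_isExpansionOn (L := L) D
  rw [traceSentence, Sentence.Realize, Formula.realize_iAlls]
  refine ((Equiv.curry (Fin k) (Fin n) U).symm.forall_congr fun {z} => ?_).symm
  rw [Formula.realize_iExs]
  refine exists_congr fun b => ?_
  rw [Formula.realize_iInf]
  refine forall_congr' fun i => ?_
  rw [Formula.realize_iff, Formula.realize_relabel, LHom.realize_onFormula,
    realize_memFormula_expansion]
  refine iff_congr ?_ Iff.rfl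
  refine iff_of_eq (congrArg φ.Realize (funext fun x => ?_))
  rcases x with x | x <;> rfl

/-- If the finite traces of `D` are traces of an NIP formula, then `e(D)` has finite
VC-dimension. -/
theorem finiteVCDim_eClass_of_trace {m : ℕ} {φ : L.Formula (Fin m ⊕ Fin n)}
    (hφ : IsNIPFormula U φ) {D : Set (Fin n → U)}
    (hD : ∀ k (z : Fin k → Fin n → U), ∃ b : Fin m → U, ∀ i, z i ∈ fiber φ b ↔ z i ∈ D) :
    FiniteVCDim (eClass L D) := by
  obtain ⟨k, hk⟩ := hφ
  refine ⟨k, fun B hB hsh => hk B hB fun H hH => ?_⟩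
  obtain ⟨C, hC, rfl⟩ := hsh H hH
  have hCk := (realize_traceSentence φ k C).1
    ((Set.ext_iff.1 hC (traceSentence φ k)).2 ((realize_traceSentence φ k D).2 (hD k)))
  let e := B.equivFinOfCardEq hB
  obtain ⟨b, hb⟩ := hCk fun i => (e.symm i).1
  refine ⟨_, ⟨b, rfl⟩, Set.ext fun z => and_congr_left fun hz => ?_⟩
  simpa using hb (e ⟨z, hz⟩)

theorem ApproximableFromBelowBy.exists_trace {m : ℕ} {φ : L.Formula (Fin m ⊕ Fin n)}
    {D : Set (Fin n → U)} (h : ApproximableFromBelowBy φ D) (k : ℕ) (z : Fin k → Fin n → U) :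
    ∃ b : Fin m → U, ∀ i, z i ∈ fiber φ b ↔ z i ∈ D := by
  obtain ⟨b, hb, -⟩ := h (Set.range (Function.uncurry z)) (Set.finite_range _)
  refine ⟨b, fun i => ?_⟩
  have hi : z i ∈ cube (Set.range (Function.uncurry z)) n := fun j => ⟨(i, j), rfl⟩
  have := Set.ext_iff.1 hb (z i)
  simpa [hi] using this

theorem realize_instantiate {m : ℕ} {V N : Type*} [L.Structure N] [L[[V]].Structure N]
    [(L.lhomWithConstants V).IsExpansionOn N] (φ : L.Formula (Fin m ⊕ Fin n)) (a : Fin n → V)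
    (v : Fin m → N) :
    (instantiate φ a).Realize v ↔
      φ.Realize (Sum.elim v fun j => ((L.con (a j) : L[[V]].Constants) : N)) := by
  rw [instantiate, Formula.Realize, BoundedFormula.realize_subst, ← Formula.Realize,
    LHom.realize_onFormula]
  refine iff_of_eq (congrArg φ.Realize (funext fun x => ?_))
  rcases x with x | x
  · rfl
  · simp

theorem realize_instantiate_self {m : ℕ} (φ : L.Formula (Fin m ⊕ Fin n)) (a : Fin n → U)
    (v : Fin m → U) : (instantiate φ a).Realize v ↔ a ∈ fiber φ v := by
  rw [realize_instantiate]
  rfl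

/-- The finite traces of an externally definable set are traces of a formula. -/
theorem ExternallyDefinable.exists_trace [Nonempty U] {D : Set (Fin n → U)}
    (h : ExternallyDefinable L D) :
    ∃ (m : ℕ) (φ : L.Formula (Fin m ⊕ Fin n)), ∀ k (z : Fin k → Fin n → U),
      ∃ b : Fin m → U, ∀ i, z i ∈ fiber φ b ↔ z i ∈ D := by
  classical
  obtain ⟨m, p, φ, rfl⟩ := h
  refine ⟨m, φ, fun k z => ?_⟩
  obtain ⟨N, v, rfl⟩ := Theory.exists_modelType_is_realized_in _ p
  simp only [Theory.CompleteType.formula_mem_typeOf, Set.mem_ofPred_eq]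
  -- The part of the type of `v` that decides the `z i`. Its existential closure is a sentence over
  -- `U` true in `N`, hence true in `U`.
  let ψ : L[[U]].Formula (Empty ⊕ Fin m) := Formula.relabel Sum.inr (Formula.iInf fun i =>
    if (instantiate φ (z i)).Realize v then instantiate φ (z i) else (instantiate φ (z i)).not)
  have hN : N ⊨ (ψ.iExs (Fin m) : L[[U]].Sentence) := by
    refine Formula.realize_iExs.2 ⟨v, ?_⟩
    rw [Formula.realize_relabel, Sum.elim_comp_inr, Formula.realize_iInf]
    intro i
    split_ifs with hi
    · exact hi
    · exact hi
  have hU : U ⊨ (ψ.iExs (Fin m) : L[[U]].Sentence) := by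
    by_contra hn
    exact Theory.realize_sentence_of_mem (L.elementaryDiagram U) (M := N)
      (φ := Formula.not (ψ.iExs (Fin m))) hn hN
  obtain ⟨b, hb⟩ := Formula.realize_iExs.1 hU
  rw [Formula.realize_relabel, Sum.elim_comp_inr, Formula.realize_iInf] at hb
  refine ⟨b, fun i => ?_⟩
  have := hb i
  split_ifs at this with hi
  · exact iff_of_true ((realize_instantiate_self _ _ _).1 this) hi
  · exact iff_of_false (fun h => this ((realize_instantiate_self _ _ _).2 h)) hi

/-- If the finite traces of `D` are traces of a formula, then `D` is externally definable. -/
theorem externallyDefinable_of_trace [Nonempty U] {m : ℕ} {φ : L.Formula (Fin m ⊕ Fin n)}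
    {D : Set (Fin n → U)}
    (hD : ∀ k (z : Fin k → Fin n → U), ∃ b : Fin m → U, ∀ i, z i ∈ fiber φ b ↔ z i ∈ D) :
    ExternallyDefinable L D := by
  classical
  let inst : (Fin n → U) → L[[U]].Formula (Fin m) := fun a =>
    if a ∈ D then instantiate φ a else (instantiate φ a).not
  -- Finitely many of the conditions in `inst` are realized in `U` by a tuple `b` with the matching
  -- trace.
  have hsat : SatFormulas (Formula.relabel Empty.elim '' L.elementaryDiagram U ∪
      Set.range inst) := by
    refine satFormulas_of_finite fun F hF hFS => ?_
    choose a ha using fun x : ↥(F ∩ Set.range inst) => x.2.2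
    have : Finite ↥(F ∩ Set.range inst) := hF.inter_of_left _
    let e := Finite.equivFin ↥(F ∩ Set.range inst)
    obtain ⟨b, hb⟩ := hD _ fun i => a (e.symm i)
    refine SatFormulas.of_realize U b fun ψ hψ => ?_
    rcases hFS hψ with ⟨σ, hσ, rfl⟩ | hr
    · exact (realize_relabel_sentence _ _).2 hσ
    · have hx := hb (e ⟨ψ, hψ, hr⟩)
      rw [Equiv.symm_apply_apply] at hx
      have := ha ⟨ψ, hψ, hr⟩
      simp only at this
      rw [← this]
      simp only [inst]
      split_ifs with haD
      · exact (realize_instantiate_self _ _ _).2 (hx.2 haD)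
      · exact fun h => haD (hx.1 ((realize_instantiate_self _ _ _).1 h))
  obtain ⟨N, _, _, v, hv⟩ := hsat.exists_realize
  have : N ⊨ L.elementaryDiagram U := ⟨fun σ hσ =>
    (realize_relabel_sentence _ _).1 (hv _ (Or.inl ⟨σ, hσ, rfl⟩))⟩
  refine ⟨m, (L.elementaryDiagram U).typeOf v, φ, Set.ext fun a => ?_⟩
  rw [Set.mem_ofPred_eq, Theory.CompleteType.formula_mem_typeOf]
  have := hv _ (Or.inr ⟨a, rfl⟩)
  simp only [inst] at this
  split_ifs at this with ha
  · exact iff_of_true ha this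
  · exact iff_of_false ha this

end Main

end ExtDef

theorem mainTheorem3 (L : FirstOrder.Language.{u, v}) (U : Type w) [L.Structure U]
    (hU : ExtDef.IsSaturated L U)
    (hκ : Cardinal.IsInaccessible (Cardinal.mk U))
    (hL : Cardinal.lift.{w} L.card < Cardinal.lift.{max u v} (Cardinal.mk U))
    (hNIP : ExtDef.IsNIP L U) (n : ℕ) (D : Set (Fin n → U)) :
    (ExtDef.ApproximableFromBelow L D ↔ ExtDef.FiniteVCDim (ExtDef.eClass L D)) ∧
    (ExtDef.ExternallyDefinable L D ↔ ExtDef.FiniteVCDim (ExtDef.eClass L D)) := by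
  have hne : Nonempty U := Cardinal.mk_ne_zero_iff.1 (Cardinal.aleph0_pos.trans hκ.1).ne'
  have hvc := ExtDef.approximableFromBelow_of_finiteVCDim (n := n) (D := D) hU hκ.1 hL
  refine ⟨⟨?_, hvc⟩, fun h => ?_, fun h => ?_⟩
  · rintro ⟨m, φ, hφ⟩
    exact ExtDef.finiteVCDim_eClass_of_trace (hNIP m n φ) hφ.exists_trace
  · obtain ⟨m, φ, hφ⟩ := h.exists_trace
    exact ExtDef.finiteVCDim_eClass_of_trace (hNIP m n φ) hφ
  -- External definability is reached through approximability from below.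
  · obtain ⟨m, φ, hφ⟩ := hvc h
    exact ExtDef.externallyDefinable_of_trace hφ.exists_trace
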